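/- Let $\mu$ be Lebesgue measure on the Borel subsets of $[0,1)$, and let $\Phi$ be the set of invertible measure-preserving transformations of $([0,1),\mu)$ with the weak topology, i.e. the topology generated by the sets $\{\tau\in\Phi:\mu(\tau A\,\triangle\,\tau_0A)<\varepsilon\}$ with $\tau_0\in\Phi$, $A$ measurable and $\varepsilon>0$. For $f:[0,1)\to\mathbb R$, $\tau\in\Phi$ and $n\ge 0$ put $S_n^\tau f=\sum_{k=0}^{n-1}f\circ\tau^k$, and for $K\in\mathbb N$ and $\eta>0$ let $$G_K(f,\eta)=\{\tau\in\Phi:\ \exists n\in\mathbb N,\ \mu\{x:|S_n^\tau f(x)|>K\}>\eta\}.$$ Theorem. Let $f:[0,1)\to\mathbb R$ be an integrable function with $\int f\,d\mu=0$ that is not a.e. equal to zero. Then: (1) there is a dense $G_\delta$ subset $G$ of $\Phi$ such that for every $\tau\in G$ there is no measurable function $h:[0,1)\to\mathbb R$ with $f=h-h\circ\tau$ a.e.; (2) for every $\eta>0$ and every $K\in\mathbb N$, the set $G_K(f,\eta)$ is open in $\Phi$; (3) there is $\eta>0$ such that for every $K\in\mathbb N$ the set $G_K(f,\eta)$ is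 dense in $\Phi$. -/

import Mathlib

open MeasureTheory Set
open scoped symmDiff

/-- The half-open unit interval `[0,1)`, with its Borel σ-algebra. -/
abbrev UnitIco : Type := ↥(Set.Ico (0 : ℝ) 1)

/-- Lebesgue measure on `[0,1)`: the restriction of Lebesgue measure on `ℝ` to the subtype. -/
noncomputable instance : MeasureSpace UnitIco := Measure.Subtype.measureSpace

/-- The set `Φ` of invertible measure-preserving transformations of `[0,1)`. -/
structure InvMPT where
  /-- the underlying bimeasurable bijection of `[0,1)` -/
  toMeasurableEquiv : UnitIco ≃ᵐ UnitIco
  /-- it preserves Lebesgue measure -/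
  measurePreserving : MeasurePreserving toMeasurableEquiv volume volume

namespace InvMPT

instance : CoeFun InvMPT (fun _ => UnitIco → UnitIco) :=
  ⟨fun τ => τ.toMeasurableEquiv⟩

/-- The weak topology on `Φ`: it is generated by the sets
`{τ | μ (τ A ∆ τ₀ A) < ε}`, for `τ₀ ∈ Φ`, `A` measurable and `ε > 0`. -/
instance : TopologicalSpace InvMPT :=
  TopologicalSpace.generateFrom
    {U | ∃ (τ₀ : InvMPT) (A : Set UnitIco) (ε : ℝ), MeasurableSet A ∧ 0 < ε ∧
      U = {τ : InvMPT | volume.real ((τ '' A) ∆ (τ₀ '' A)) < ε}}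

/-- `f` is a `τ`-coboundary with a measurable transfer function `h`: `f = h - h ∘ τ` a.e. -/
def IsCoboundary (f : UnitIco → ℝ) (τ : InvMPT) : Prop :=
  ∃ h : UnitIco → ℝ, Measurable h ∧ f =ᵐ[volume] fun x => h x - h (τ x)

/-- `G_K(f, η)`: the transformations `τ` such that for some `n` the sum
`S_n^τ f = ∑_{k < n} f ∘ τ^k` exceeds `K` in absolute value on a set of measure `> η`. -/
def largeSums (f : UnitIco → ℝ) (K : ℕ) (η : ℝ) : Set InvMPT :=
  {τ | ∃ n : ℕ, η < volume.real {x : UnitIco | (K : ℝ) < |birkhoffSum τ f n x|}}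

end InvMPT

/-!
The set `⋂ K, largeSums f K η` consists of the transformations `τ` whose Birkhoff sums are
stochastically unbounded, with mass at least `η` escaping. No such `τ` admits a transfer function,
since `f = h - h ∘ τ` gives `S_n f = h - h ∘ τ^n`, which is tight
(`not_isCoboundary_of_forall_mem_largeSums`). Each `largeSums f K η` is open, because
`τ ↦ f ∘ τ^k` is continuous from the weak topology to `L¹` (`tendsto_lintegral_comp_iterate`), and
hence `τ ↦ S_n^τ f` is continuous in measure. So everything follows once the intersection itself is
dense for some `η > 0`; this is shown directly, without a Baire category argument.

Let `0 < η < μ {f ≠ 0}`. If every orbit of `τ` on a set of measure larger than `η` is finite, of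
length dividing a fixed `M`, and the sum of `f` over it is nonzero, then `S_{jM} f = j S_M f`
exceeds every bound there as `j → ∞` (`mem_largeSums_of_isPeriodicPt`). Such `τ` are dense for two
reasons.

* Every `τ₀` is approximated by a `σ` all of whose orbits have the same large length `T`
  (`exists_periodic_symmDiff_lt`). The finitely many sets defining the neighbourhood, and their
  images under `τ₀`, are nearly unions of the cells `[i/n, (i+1)/n)`. Only the transition
  frequencies `μ {x ∈ i-th cell, τ₀ x ∈ j-th cell}` then matter, and these are reproduced up to
  rounding by a permutation of `S` equal subcells of each cell (`exists_perm_transition_le`). A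
  rotation inside the subcells makes all orbits equally long.
* If `f` sums to zero over an orbit of `σ` but `f z ≠ 0` at a point `z` of it, then making `z` a
  fixed point and letting the rest of the orbit jump over `z` changes the sum to `-f z ≠ 0`
  (`exists_birkhoffSum_ne_zero`). One point is removed per orbit, so this alters `σ` only on a set
  of measure at most `2 / T`.
-/

namespace InvMPT

open Filter Topology Function ProbabilityTheory

instance instIsProbabilityMeasureUnitIco : IsProbabilityMeasure (volume : Measure UnitIco) :=
  ⟨by simp [Measure.Subtype.volume_univ measurableSet_Ico.nullMeasurableSet]⟩

/-! ### Iterates and neighbourhoods in the weak topology -/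

theorem measurePreserving_iterate (τ : InvMPT) (k : ℕ) :
    MeasurePreserving (τ^[k]) volume volume :=
  τ.measurePreserving.iterate k

theorem measure_image (τ : InvMPT) (A : Set UnitIco) : volume (τ '' A) = volume A := by
  rw [← τ.measurePreserving.measure_preimage_equiv (τ '' A),
    preimage_image_eq _ τ.toMeasurableEquiv.injective]

theorem measurableSet_image (τ : InvMPT) {A : Set UnitIco} (hA : MeasurableSet A) :
    MeasurableSet (τ '' A) :=
  τ.toMeasurableEquiv.measurableSet_image.2 hA

theorem eventually_symmDiff_image_lt (τ₀ : InvMPT) {A : Set UnitIco} (hA : MeasurableSet A)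
    {ε : ℝ} (hε : 0 < ε) : ∀ᶠ τ : InvMPT in 𝓝 τ₀, volume.real ((τ '' A) ∆ (τ₀ '' A)) < ε := by
  refine IsOpen.mem_nhds (TopologicalSpace.isOpen_generateFrom_of_mem
    ⟨τ₀, A, ε, hA, hε, rfl⟩) ?_
  simpa using hε

/-- Finitely many conditions `μ(τ A ∆ τ₀ A) < ε` centred at `τ₀` itself form a basis of
neighbourhoods of `τ₀`. -/
theorem exists_finset_symmDiff_subset {U : Set InvMPT} (hU : IsOpen U) (τ₀ : InvMPT)
    (h₀ : τ₀ ∈ U) : ∃ (F : Finset (Set UnitIco)) (ε : ℝ), 0 < ε ∧ (∀ A ∈ F, MeasurableSet A) ∧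
      ∀ τ : InvMPT, (∀ A ∈ F, volume.real ((τ '' A) ∆ (τ₀ '' A)) < ε) → τ ∈ U := by
  classical
  induction hU with
  | basic s hs =>
    obtain ⟨τ₁, A, ε, hA, hε, rfl⟩ := hs
    refine ⟨{A}, ε - volume.real ((τ₀ '' A) ∆ (τ₁ '' A)), sub_pos.2 h₀, by simpa using hA, ?_⟩
    intro τ hτ
    have h := hτ A (by simp)
    have h' := measureReal_symmDiff_le (μ := volume) (s := τ '' A) (t := τ₀ '' A) (τ₁ '' A)
    simp only [mem_ofPred_eq]
    linarith
  | univ => exact ⟨∅, 1, one_pos, by simp, fun _ _ => mem_univ _⟩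
  | inter s t _ _ hs ht =>
    obtain ⟨F, ε, hε, hF, h⟩ := hs h₀.1
    obtain ⟨F', ε', hε', hF', h'⟩ := ht h₀.2
    refine ⟨F ∪ F', min ε ε', lt_min hε hε', ?_, fun τ hτ => ⟨?_, ?_⟩⟩
    · intro A hA
      rcases Finset.mem_union.1 hA with hA | hA
      exacts [hF A hA, hF' A hA]
    · exact h τ fun A hA => (hτ A (Finset.mem_union_left _ hA)).trans_le (min_le_left _ _)
    · exact h' τ fun A hA => (hτ A (Finset.mem_union_right _ hA)).trans_le (min_le_right _ _)
  | sUnion S _ ih =>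
    obtain ⟨s, hs, hs₀⟩ := h₀
    obtain ⟨F, ε, hε, hF, h⟩ := ih s hs hs₀
    exact ⟨F, ε, hε, hF, fun τ hτ => ⟨s, hs, h τ hτ⟩⟩

/-! ### Birkhoff sums depend continuously on the transformation -/

theorem tendsto_symmDiff_preimage (τ₀ : InvMPT) {A : Set UnitIco} (hA : MeasurableSet A) :
    Tendsto (fun τ : InvMPT => volume ((τ ⁻¹' A) ∆ (τ₀ ⁻¹' A))) (𝓝 τ₀) (𝓝 0) := by
  have key : ∀ τ : InvMPT, volume ((τ ⁻¹' A) ∆ (τ₀ ⁻¹' A)) =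
      volume ((τ '' (τ₀ ⁻¹' A)) ∆ (τ₀ '' (τ₀ ⁻¹' A))) := by
    intro τ
    rw [image_preimage_eq _ τ₀.toMeasurableEquiv.surjective, ← measure_image τ,
      image_symmDiff τ.toMeasurableEquiv.injective,
      image_preimage_eq _ τ.toMeasurableEquiv.surjective, symmDiff_comm]
  simp_rw [key]
  rw [ENNReal.tendsto_nhds_zero]
  intro ε hε
  rcases eq_or_ne ε ⊤ with rfl | hε'
  · simp
  filter_upwards [eventually_symmDiff_image_lt τ₀ (τ₀.measurePreserving.measurable hA)
    (ENNReal.toReal_pos hε.ne' hε')] with τ hτ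
  exact ((ENNReal.toReal_lt_toReal (measure_ne_top _ _) hε').1 hτ).le

theorem tendsto_symmDiff_preimage_iterate (τ₀ : InvMPT) (k : ℕ) {A : Set UnitIco}
    (hA : MeasurableSet A) :
    Tendsto (fun τ : InvMPT => volume ((τ^[k] ⁻¹' A) ∆ (τ₀^[k] ⁻¹' A))) (𝓝 τ₀) (𝓝 0) := by
  induction k with
  | zero => simp
  | succ k ih =>
    have hB : MeasurableSet (τ₀^[k] ⁻¹' A) := (τ₀.measurePreserving_iterate k).measurable hA
    have h := ih.add (tendsto_symmDiff_preimage τ₀ hB)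
    rw [add_zero] at h
    refine tendsto_of_tendsto_of_tendsto_of_le_of_le tendsto_const_nhds h
      (fun _ => zero_le) fun τ => ?_
    simp only [iterate_succ, preimage_comp]
    refine (measure_symmDiff_le _ (τ ⁻¹' (τ₀^[k] ⁻¹' A)) _).trans (add_le_add_left ?_ _)
    rw [← preimage_symmDiff, τ.measurePreserving.measure_preimage_equiv]

/-- For integrable `f`, the map `τ ↦ f ∘ τ^k` is continuous from the weak topology to `L¹`. -/
theorem tendsto_lintegral_comp_iterate {f : UnitIco → ℝ} (hf : Integrable f) (τ₀ : InvMPT)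
    (k : ℕ) :
    Tendsto (fun τ : InvMPT => ∫⁻ x, ‖f (τ^[k] x) - f (τ₀^[k] x)‖ₑ) (𝓝 τ₀) (𝓝 0) := by
  rw [ENNReal.tendsto_nhds_zero]
  intro ε hε
  have hε3 : ε / 3 ≠ 0 := (ENNReal.div_pos hε.ne' (by simp)).ne'
  obtain ⟨g, hfg, hg, hgt⟩ := (memLp_one_iff_integrable.2 hf).induction_dense
    (P := fun g => AEStronglyMeasurable g volume ∧
      Tendsto (fun τ : InvMPT => ∫⁻ x, ‖g (τ^[k] x) - g (τ₀^[k] x)‖ₑ) (𝓝 τ₀) (𝓝 0)) (by simp)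
    (fun c s hs _ ε _ => by
      refine ⟨s.indicator fun _ => c, by simp,
        (measurable_const.indicator hs).aestronglyMeasurable, ?_⟩
      have h := ENNReal.Tendsto.const_mul (a := ‖c‖ₑ)
        (tendsto_symmDiff_preimage_iterate τ₀ k hs) (Or.inr (by simp))
      rw [mul_zero] at h
      refine tendsto_of_tendsto_of_tendsto_of_le_of_le tendsto_const_nhds h
        (fun _ => zero_le) fun τ => ?_
      refine le_trans (lintegral_mono
        (g := ((τ^[k] ⁻¹' s) ∆ (τ₀^[k] ⁻¹' s)).indicator fun _ => ‖c‖ₑ) fun x => ?_)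
        (lintegral_indicator_const_le _ _)
      by_cases h1 : τ^[k] x ∈ s <;> by_cases h2 : τ₀^[k] x ∈ s <;>
        simp [indicator, mem_symmDiff, h1, h2])
    (fun g g' hg hg' => by
      refine ⟨hg.1.add hg'.1, ?_⟩
      have h := hg.2.add hg'.2
      rw [add_zero] at h
      refine tendsto_of_tendsto_of_tendsto_of_le_of_le tendsto_const_nhds h
        (fun _ => zero_le) fun τ => ?_
      refine le_trans (lintegral_mono fun x => ?_) (lintegral_add_left' ?_ _).le
      · simp only [Pi.add_apply, add_sub_add_comm]
        exact enorm_add_le _ _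
      · exact ((hg.1.comp_measurePreserving (τ.measurePreserving_iterate k)).sub
          (hg.1.comp_measurePreserving (τ₀.measurePreserving_iterate k))).enorm)
    (fun g hg => hg.1) hε3
  rw [eLpNorm_one_eq_lintegral_enorm] at hfg
  have hfgm : AEStronglyMeasurable (f - g) volume := hf.1.sub hg
  have hcomp : ∀ τ : InvMPT, ∫⁻ x, ‖(f - g) (τ^[k] x)‖ₑ ≤ ε / 3 := fun τ => by
    refine le_trans (le_of_eq ?_) hfg
    have hmp := τ.measurePreserving_iterate k
    have h := lintegral_map' (f := fun x => ‖(f - g) x‖ₑ) (by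
      rw [hmp.map_eq]; exact hfgm.enorm) hmp.aemeasurable
    rw [hmp.map_eq] at h
    exact h.symm
  filter_upwards [ENNReal.tendsto_nhds_zero.1 hgt _ (pos_iff_ne_zero.2 hε3)] with τ hτ
  calc ∫⁻ x, ‖f (τ^[k] x) - f (τ₀^[k] x)‖ₑ
      ≤ ∫⁻ x, (‖(f - g) (τ^[k] x)‖ₑ + ‖(f - g) (τ₀^[k] x)‖ₑ
        + ‖g (τ^[k] x) - g (τ₀^[k] x)‖ₑ) := by
        refine lintegral_mono fun x => ?_
        have : f (τ^[k] x) - f (τ₀^[k] x) = ((f - g) (τ^[k] x) - (f - g) (τ₀^[k] x))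
          + (g (τ^[k] x) - g (τ₀^[k] x)) := by simp only [Pi.sub_apply]; ring
        rw [this]
        exact (enorm_add_le _ _).trans (add_le_add_left enorm_sub_le _)
    _ = (∫⁻ x, ‖(f - g) (τ^[k] x)‖ₑ) + (∫⁻ x, ‖(f - g) (τ₀^[k] x)‖ₑ)
        + ∫⁻ x, ‖g (τ^[k] x) - g (τ₀^[k] x)‖ₑ := by
        have h (τ : InvMPT) := (hfgm.comp_measurePreserving (τ.measurePreserving_iterate k)).enorm
        exact (lintegral_add_left' ((h τ).add (h τ₀)) _).trans
          (congrArg (· + _) (lintegral_add_left' (h τ) _))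
    _ ≤ ε / 3 + ε / 3 + ε / 3 := by gcongr; exacts [hcomp τ, hcomp τ₀]
    _ = ε := ENNReal.add_thirds ε

theorem tendsto_lintegral_birkhoffSum {f : UnitIco → ℝ} (hf : Integrable f) (τ₀ : InvMPT)
    (n : ℕ) :
    Tendsto (fun τ : InvMPT => ∫⁻ x, ‖birkhoffSum τ f n x - birkhoffSum τ₀ f n x‖ₑ)
      (𝓝 τ₀) (𝓝 0) := by
  have h := tendsto_finsetSum (Finset.range n)
    fun k _ => tendsto_lintegral_comp_iterate hf τ₀ k
  rw [Finset.sum_const_zero] at h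
  refine tendsto_of_tendsto_of_tendsto_of_le_of_le tendsto_const_nhds h
    (fun _ => zero_le) fun τ => ?_
  refine le_trans (lintegral_mono fun x => ?_) (lintegral_finsetSum' _ fun k _ => ?_).le
  · simp only [birkhoffSum, ← Finset.sum_sub_distrib]
    exact enorm_sum_le _ _
  · exact ((hf.1.comp_measurePreserving (τ.measurePreserving_iterate k)).sub
      (hf.1.comp_measurePreserving (τ₀.measurePreserving_iterate k))).enorm

theorem aestronglyMeasurable_birkhoffSum {f : UnitIco → ℝ} (hf : AEStronglyMeasurable f volume)
    (τ : InvMPT) (n : ℕ) : AEStronglyMeasurable (birkhoffSum τ f n) volume := by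
  have : birkhoffSum τ f n = ∑ k ∈ Finset.range n, f ∘ τ^[k] := by
    ext x; simp [birkhoffSum]
  rw [this]
  exact Finset.aestronglyMeasurable_sum _
    fun k _ => hf.comp_measurePreserving (τ.measurePreserving_iterate k)

theorem isOpen_largeSums {f : UnitIco → ℝ} (hf : Integrable f) (K : ℕ) (η : ℝ) :
    IsOpen (largeSums f K η) := by
  rw [isOpen_iff_mem_nhds]
  rintro τ₀ ⟨n, hn⟩
  -- some strict margin above `K` already carries measure larger than `η`
  obtain ⟨j, hj⟩ : ∃ j : ℕ, η <
      volume.real {x : UnitIco | (K : ℝ) + 1 / (j + 1) < |birkhoffSum τ₀ f n x|} := by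
    have hmono : Monotone fun j : ℕ =>
        {x : UnitIco | (K : ℝ) + 1 / (j + 1) < |birkhoffSum τ₀ f n x|} := by
      intro i j hij x hx
      simp only [mem_ofPred_eq] at hx ⊢
      have : (1 : ℝ) / (j + 1) ≤ 1 / (i + 1) := Nat.one_div_le_one_div hij
      linarith
    have hU : (⋃ j : ℕ, {x : UnitIco | (K : ℝ) + 1 / (j + 1) < |birkhoffSum τ₀ f n x|}) =
        {x : UnitIco | (K : ℝ) < |birkhoffSum τ₀ f n x|} := by
      ext x
      simp only [mem_iUnion, mem_ofPred_eq]
      constructor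
      · rintro ⟨j, hj⟩
        have : (0 : ℝ) < 1 / (j + 1) := Nat.one_div_pos_of_nat
        linarith
      · intro hx
        obtain ⟨j, hj⟩ := exists_nat_one_div_lt (sub_pos.2 hx)
        exact ⟨j, by linarith⟩
    have ht := tendsto_measure_iUnion_atTop (μ := volume) hmono
    rw [hU] at ht
    have ht' := (ENNReal.tendsto_toReal (measure_ne_top volume _)).comp ht
    exact (ht'.eventually (lt_mem_nhds hn)).exists
  set δ : ℝ := 1 / (j + 1) with hδ
  have hδ0 : 0 < δ := Nat.one_div_pos_of_nat
  set A := {x : UnitIco | (K : ℝ) + δ < |birkhoffSum τ₀ f n x|} with hA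
  have hc : 0 < (volume.real A - η) / 2 := by linarith
  have hpos : 0 < ENNReal.ofReal δ * ENNReal.ofReal ((volume.real A - η) / 2) := by
    simp only [CanonicallyOrderedAdd.mul_pos, ENNReal.ofReal_pos]; exact ⟨hδ0, hc⟩
  filter_upwards [ENNReal.tendsto_nhds_zero.1 (tendsto_lintegral_birkhoffSum hf τ₀ n) _ hpos]
    with τ hτ
  refine ⟨n, ?_⟩
  set C := {x : UnitIco | ENNReal.ofReal δ ≤ ‖birkhoffSum τ f n x - birkhoffSum τ₀ f n x‖ₑ}
  have hC : volume.real C ≤ (volume.real A - η) / 2 := by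
    have h1 := (mul_meas_ge_le_lintegral₀ ((aestronglyMeasurable_birkhoffSum hf.1 τ n).sub
      (aestronglyMeasurable_birkhoffSum hf.1 τ₀ n)).enorm (ENNReal.ofReal δ)).trans hτ
    rw [ENNReal.mul_le_mul_iff_right (by simpa using hδ0) (by simp)] at h1
    exact ENNReal.toReal_le_of_le_ofReal hc.le h1
  have hsub : A ⊆ {x : UnitIco | (K : ℝ) < |birkhoffSum τ f n x|} ∪ C := by
    intro x hx
    by_contra hcon
    simp only [mem_union, mem_ofPred_eq, not_or, not_lt, not_le, C] at hcon
    obtain ⟨h1, h2⟩ := hcon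
    rw [Real.enorm_eq_ofReal_abs, ENNReal.ofReal_lt_ofReal_iff hδ0] at h2
    have h3 : (K : ℝ) + δ < |birkhoffSum τ₀ f n x| := hx
    have h4 := abs_sub_abs_le_abs_sub (birkhoffSum τ₀ f n x) (birkhoffSum τ f n x)
    rw [abs_sub_comm] at h4
    linarith
  have := (measureReal_mono (μ := volume) hsub).trans (measureReal_union_le _ _)
  linarith

/-! ### Coboundaries have stochastically bounded Birkhoff sums -/

theorem birkhoffSum_ae_eq_of_coboundary {f h : UnitIco → ℝ} {τ : InvMPT}
    (hfh : f =ᵐ[volume] fun x => h x - h (τ x)) (n : ℕ) :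
    birkhoffSum τ f n =ᵐ[volume] fun x => h x - h (τ^[n] x) := by
  filter_upwards [τ.measurePreserving.quasiMeasurePreserving.birkhoffSum_ae_eq_of_ae_eq hfh n]
    with x hx
  rw [hx, birkhoffSum]
  simp only [← iterate_succ_apply']
  exact Finset.sum_range_sub' (fun k => h (τ^[k] x)) n

theorem not_isCoboundary_of_forall_mem_largeSums {f : UnitIco → ℝ} {τ : InvMPT} {η : ℝ}
    (hη : 0 < η) (hτ : ∀ K : ℕ, τ ∈ largeSums f K η) : ¬ IsCoboundary f τ := by
  rintro ⟨h, hm, hfh⟩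
  have hanti : Antitone fun K : ℕ => {x : UnitIco | (K : ℝ) / 2 < |h x|} := by
    intro i j hij x hx
    have : (i : ℝ) ≤ j := by exact_mod_cast hij
    simp only [mem_ofPred_eq] at hx ⊢
    linarith
  have hmeas (K : ℕ) : MeasurableSet {x : UnitIco | (K : ℝ) / 2 < |h x|} :=
    measurableSet_lt measurable_const hm.abs
  have ht := tendsto_measure_iInter_atTop (μ := volume)
    (fun K => (hmeas K).nullMeasurableSet) hanti ⟨0, measure_ne_top _ _⟩
  have hI : (⋂ K : ℕ, {x : UnitIco | (K : ℝ) / 2 < |h x|}) = ∅ := by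
    refine eq_empty_of_forall_notMem fun x hx => ?_
    obtain ⟨K, hK⟩ := exists_nat_gt (2 * |h x|)
    have := mem_iInter.1 hx K
    simp only [mem_ofPred_eq] at this
    linarith
  rw [hI, measure_empty] at ht
  have ht' := (ENNReal.tendsto_toReal ENNReal.zero_ne_top).comp ht
  obtain ⟨K, hK⟩ := (ht'.eventually (gt_mem_nhds (half_pos hη))).exists
  obtain ⟨n, hn⟩ := hτ K
  set B := {x : UnitIco | (K : ℝ) / 2 < |h x|}
  have hK' : volume.real B < η / 2 := hK
  have hsub : {x : UnitIco | (K : ℝ) < |birkhoffSum τ f n x|} ≤ᵐ[volume]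
      (B ∪ τ^[n] ⁻¹' B : Set UnitIco) := by
    filter_upwards [birkhoffSum_ae_eq_of_coboundary hfh n] with x hx hx'
    by_contra hcon
    have h1 : ¬ (x ∈ B ∨ τ^[n] x ∈ B) := hcon
    have h2 : (K : ℝ) < |birkhoffSum τ f n x| := hx'
    simp only [B, mem_ofPred_eq, not_or, not_lt] at h1
    rw [hx] at h2
    have := abs_sub (h x) (h (τ^[n] x))
    linarith
  have h1 := ENNReal.toReal_mono (measure_ne_top volume _) (measure_mono_ae hsub)
  have h2 : volume.real (τ^[n] ⁻¹' B) = volume.real B :=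
    (τ.measurePreserving_iterate n).measureReal_preimage (hmeas K).nullMeasurableSet
  have h3 := measureReal_union_le (μ := volume) B (τ^[n] ⁻¹' B)
  change volume.real _ ≤ volume.real _ at h1
  linarith

/-! ### The uniform measure on a finite set -/

theorem uniformOn_univ_singleton {ι : Type*} [Fintype ι] [MeasurableSpace ι]
    [MeasurableSingletonClass ι] (i : ι) :
    uniformOn (univ : Set ι) {i} = (Fintype.card ι : ENNReal)⁻¹ := by
  rw [uniformOn_univ, Measure.count_singleton, one_div]

instance instIsProbabilityMeasureUniformOnUniv {ι : Type*} [Finite ι] [Nonempty ι]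
    [MeasurableSpace ι] [MeasurableSingletonClass ι] :
    IsProbabilityMeasure (uniformOn (univ : Set ι)) :=
  isProbabilityMeasure_uniformOn finite_univ univ_nonempty

theorem uniformOn_univ_prod {ι κ : Type*} [Fintype ι] [Nonempty ι] [MeasurableSpace ι]
    [MeasurableSingletonClass ι] [Fintype κ] [Nonempty κ] [MeasurableSpace κ]
    [MeasurableSingletonClass κ] :
    (uniformOn (univ : Set ι)).prod (uniformOn (univ : Set κ)) =
      uniformOn (univ : Set (ι × κ)) := by
  refine Measure.ext_of_singleton fun ⟨i, k⟩ => ?_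
  rw [← singleton_prod_singleton, Measure.prod_prod, singleton_prod_singleton,
    uniformOn_univ_singleton, uniformOn_univ_singleton, uniformOn_univ_singleton,
    Fintype.card_prod, Nat.cast_mul, ENNReal.mul_inv (by simp) (by simp)]

theorem measurePreserving_perm {ι : Type*} [Fintype ι] [MeasurableSpace ι]
    [MeasurableSingletonClass ι] (q : Equiv.Perm ι) :
    MeasurePreserving q (uniformOn (univ : Set ι)) (uniformOn (univ : Set ι)) := by
  refine ⟨.of_discrete, Measure.ext_of_singleton fun i => ?_⟩
  rw [Measure.map_apply .of_discrete (measurableSet_singleton i), ← Equiv.image_symm_eq_preimage,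
    image_singleton, uniformOn_univ_singleton, uniformOn_univ_singleton]

/-! ### Splitting the interval into cells of equal length -/

/-- `[0,1)` is the union of the `n` cells `[i/n, (i+1)/n)`, each a copy of `[0,1)` scaled by
`1/n`: the point `x` corresponds to the index of its cell together with its rescaled position
`fract (n x)` in that cell. -/
noncomputable def cellEquiv (n : ℕ) [NeZero n] : UnitIco ≃ᵐ Fin n × UnitIco where
  toFun x := (⟨⌊(n : ℝ) * x⌋₊, by
      have hn : (0 : ℝ) < n := by exact_mod_cast NeZero.pos n
      have := x.2.2
      rw [Nat.floor_lt (mul_nonneg hn.le x.2.1)]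
      nlinarith⟩,
    ⟨Int.fract ((n : ℝ) * x), Int.fract_nonneg _, Int.fract_lt_one _⟩)
  invFun p := ⟨((p.1 : ℕ) + (p.2 : ℝ)) / n, by
    have hn : (0 : ℝ) < n := by exact_mod_cast NeZero.pos n
    have h1 : ((p.1 : ℕ) : ℝ) + 1 ≤ n := by exact_mod_cast p.1.2
    have h2 := p.2.2.1
    have h3 := p.2.2.2
    refine ⟨by positivity, ?_⟩
    rw [div_lt_one hn]
    linarith⟩
  left_inv x := by
    have hn : (0 : ℝ) < n := by exact_mod_cast NeZero.pos n
    ext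
    simp only
    rw [natCast_floor_eq_intCast_floor (mul_nonneg hn.le x.2.1), Int.floor_add_fract,
      mul_div_cancel_left₀ _ hn.ne']
  right_inv p := by
    have hn : (n : ℝ) ≠ 0 := by exact_mod_cast NeZero.ne n
    have h0 : ⌊(p.2 : ℝ)⌋₊ = 0 := Nat.floor_eq_zero.2 p.2.2.2
    have h1 : Int.fract (p.2 : ℝ) = p.2 := Int.fract_eq_self.2 p.2.2
    ext
    · simp only [mul_div_cancel₀ _ hn]
      rw [add_comm, Nat.floor_add_natCast p.2.2.1, h0, zero_add]
    · simp only [mul_div_cancel₀ _ hn, Int.fract_natCast_add, h1]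
  measurable_toFun := by
    refine Measurable.prodMk (measurable_to_countable' fun i => ?_) ?_
    · have : Measurable fun x : UnitIco => ⌊(n : ℝ) * x⌋₊ :=
        Nat.measurable_floor.comp (measurable_subtype_coe.const_mul _)
      convert this (measurableSet_singleton (i : ℕ)) using 1
      ext x
      simp [Fin.ext_iff]
    · exact (measurable_fract.comp (measurable_subtype_coe.const_mul _)).subtype_mk
  measurable_invFun := by
    refine Measurable.subtype_mk (Measurable.div_const (Measurable.add ?_ ?_) _)
    · exact (Measurable.of_discrete (f := fun i : Fin n => ((i : ℕ) : ℝ))).comp measurable_fst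
    · exact measurable_subtype_coe.comp measurable_snd

theorem abs_sub_lt_of_cellEquiv_fst_eq {n : ℕ} [NeZero n] {x y : UnitIco}
    (h : (cellEquiv n x).1 = (cellEquiv n y).1) : |(x : ℝ) - y| < 1 / n := by
  have hn : (0 : ℝ) < n := by exact_mod_cast NeZero.pos n
  have h' : ⌊(n : ℝ) * x⌋₊ = ⌊(n : ℝ) * y⌋₊ := congrArg Fin.val h
  have hx := Nat.floor_le (mul_nonneg hn.le x.2.1)
  have hx' := Nat.lt_floor_add_one ((n : ℝ) * x)
  have hy := Nat.floor_le (mul_nonneg hn.le y.2.1)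
  have hy' := Nat.lt_floor_add_one ((n : ℝ) * y)
  rw [h'] at hx hx'
  rw [abs_lt, neg_lt, lt_div_iff₀ hn, lt_div_iff₀ hn]
  constructor <;> linarith

theorem measurePreserving_cellEquiv (n : ℕ) [NeZero n] :
    MeasurePreserving (cellEquiv n) volume ((uniformOn (univ : Set (Fin n))).prod volume) := by
  have hn : (0 : ℝ) < n := by exact_mod_cast NeZero.pos n
  refine MeasurePreserving.symm (e := (cellEquiv n).symm) ⟨(cellEquiv n).symm.measurable, ?_⟩
  ext B hB
  rw [Measure.map_apply (cellEquiv n).symm.measurable hB,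
    Measure.prod_apply ((cellEquiv n).symm.measurable hB), lintegral_fintype]
  -- the slice over `i` is the part of `B` in the `i`-th cell, expanded by the factor `n`
  have key (i : Fin n) :
      volume (Prod.mk i ⁻¹' ((cellEquiv n).symm ⁻¹' B)) * uniformOn (univ : Set (Fin n)) {i} =
        volume (B ∩ {x | (cellEquiv n x).1 = i}) := by
    rw [← volume_image_subtype_coe measurableSet_Ico, ← volume_image_subtype_coe measurableSet_Ico]
    have himg : ((↑) '' (Prod.mk i ⁻¹' ((cellEquiv n).symm ⁻¹' B)) : Set ℝ) =
        (fun t => (n : ℝ)⁻¹ * t) ⁻¹' ((fun t => ((i : ℕ) : ℝ) / n + t) ⁻¹'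
          ((↑) '' (B ∩ {x | (cellEquiv n x).1 = i}) : Set ℝ)) := by
      ext t
      simp only [mem_image, mem_preimage]
      constructor
      · rintro ⟨y, hy, rfl⟩
        refine ⟨(cellEquiv n).symm (i, y), ⟨hy, by simp⟩, ?_⟩
        change (((i : ℕ) : ℝ) + y) / n = _
        ring
      · rintro ⟨x, ⟨hx, hxi⟩, hxt⟩
        have hxi' : (cellEquiv n x) = (i, (cellEquiv n x).2) := by
          rw [← (show _ = i from hxi)]
        refine ⟨(cellEquiv n x).2, ?_, ?_⟩
        · rw [← hxi', MeasurableEquiv.symm_apply_apply]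
          exact hx
        · have h1 : (((cellEquiv n).symm (i, (cellEquiv n x).2) : UnitIco) : ℝ) = x := by
            rw [← hxi', MeasurableEquiv.symm_apply_apply]
          change (((i : ℕ) : ℝ) + ((cellEquiv n x).2 : ℝ)) / n = x at h1
          rw [hxt] at h1
          field_simp at h1
          linarith
    rw [himg, Real.volume_preimage_mul_left (inv_ne_zero hn.ne'), measure_preimage_add,
      uniformOn_univ_singleton, Fintype.card_fin, inv_inv, abs_of_pos hn,
      ENNReal.ofReal_natCast, mul_right_comm, ENNReal.mul_inv_cancel (by exact_mod_cast hn.ne')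
      (by simp), one_mul]
  simp_rw [key]
  rw [← tsum_fintype (L := .unconditional _), ← measure_iUnion]
  · congr 1
    ext x
    simp
  · intro i j hij
    refine disjoint_left.2 fun x hx hx' => hij ?_
    exact hx.2.symm.trans hx'.2
  · intro i
    exact hB.inter ((cellEquiv n).measurable.fst (measurableSet_singleton i))

/-- Every measurable set is, up to small measure, a union of cells `[i/n, (i+1)/n)`, for every
large `n`. -/
theorem eventually_exists_symmDiff_cells_lt {A : Set UnitIco} (hA : MeasurableSet A) {ε : ℝ}
    (hε : 0 < ε) : ∀ᶠ n : ℕ in atTop, ∀ _ : NeZero n, ∃ J : Set (Fin n),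
      volume.real (A ∆ {x | (cellEquiv n x).1 ∈ J}) < ε := by
  have hA' : MeasurableSet ((↑) '' A : Set ℝ) := measurableSet_Ico.subtype_image hA
  have hAtop : volume ((↑) '' A : Set ℝ) ≠ ⊤ := by
    rw [volume_image_subtype_coe measurableSet_Ico]; exact measure_ne_top _ _
  have hε2 : ENNReal.ofReal (ε / 2) ≠ 0 := by simpa using hε
  obtain ⟨K, hKA, hK, hKm⟩ := hA'.exists_isCompact_sdiff_lt hAtop hε2
  obtain ⟨U, hAU, hU, -, hUm⟩ := hA'.exists_isOpen_sdiff_lt hAtop hε2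
  obtain ⟨δ, hδ, hδU⟩ := hK.exists_thickening_subset_open hU (hKA.trans hAU)
  obtain ⟨N, hN⟩ := exists_nat_one_div_lt hδ
  filter_upwards [eventually_gt_atTop N] with n hn hn0
  -- the cells that meet the compact set `K`
  refine ⟨{i | ∃ y : UnitIco, (y : ℝ) ∈ K ∧ (cellEquiv n y).1 = i}, ?_⟩
  have hsub : ((↑) '' (A ∆ {x | (cellEquiv n x).1 ∈
      {i | ∃ y : UnitIco, (y : ℝ) ∈ K ∧ (cellEquiv n y).1 = i}}) : Set ℝ) ⊆
      ((↑) '' A \ K) ∪ (U \ (↑) '' A) := by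
    rintro _ ⟨x, hx | hx, rfl⟩
    · exact Or.inl ⟨mem_image_of_mem _ hx.1, fun hxK => hx.2 ⟨x, hxK, rfl⟩⟩
    · obtain ⟨⟨y, hy, hyx⟩, hxA⟩ := hx
      refine Or.inr ⟨hδU (Metric.mem_thickening_iff.2 ⟨y, hy, ?_⟩), ?_⟩
      · rw [Real.dist_eq]
        refine (abs_sub_lt_of_cellEquiv_fst_eq hyx.symm).trans (lt_of_le_of_lt ?_ hN)
        have : (N : ℝ) + 1 ≤ n := by exact_mod_cast hn
        gcongr
      · rintro ⟨z, hz, hzx⟩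
        exact hxA (Subtype.ext hzx ▸ hz)
  have h := (measure_mono (μ := volume) hsub).trans (measure_union_le _ _)
  rw [volume_image_subtype_coe measurableSet_Ico] at h
  have h2 := h.trans_lt (ENNReal.add_lt_add hKm hUm)
  rw [← ENNReal.ofReal_add (by positivity) (by positivity), add_halves] at h2
  exact (ENNReal.lt_ofReal_iff_toReal_lt (measure_ne_top _ _)).1 h2

/-! ### Transformations permuting blocks -/

/-- Given an identification `e` of `[0,1)` with `ι × [0,1)`, the transformation that permutes the
blocks by `q` and acts inside the blocks by `R`. -/
noncomputable def blockPerm {ι : Type*} [Fintype ι] [Nonempty ι] [MeasurableSpace ι]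
    [MeasurableSingletonClass ι] (e : UnitIco ≃ᵐ ι × UnitIco)
    (he : MeasurePreserving e volume ((uniformOn (univ : Set ι)).prod volume))
    (q : Equiv.Perm ι) (R : InvMPT) : InvMPT where
  toMeasurableEquiv := (e.trans (MeasurableEquiv.prodCongr
    ⟨q, .of_discrete, .of_discrete⟩ R.toMeasurableEquiv)).trans e.symm
  measurePreserving := (he.symm e).comp
    (((measurePreserving_perm q).prod R.measurePreserving).comp he)

theorem volume_real_fst_mem {ι : Type*} [Fintype ι] [MeasurableSpace ι]
    [MeasurableSingletonClass ι] (e : UnitIco ≃ᵐ ι × UnitIco)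
    (he : MeasurePreserving e volume ((uniformOn (univ : Set ι)).prod volume)) (s : Set ι) :
    volume.real {x | (e x).1 ∈ s} = s.ncard / Fintype.card ι := by
  have h : {x | (e x).1 ∈ s} = e ⁻¹' (s ×ˢ univ) := by ext; simp
  rw [h, measureReal_def, he.measure_preimage_equiv, Measure.prod_prod, measure_univ, mul_one,
    uniformOn_univ, Measure.count_apply_finite _ s.toFinite, ncard_eq_toFinset_card,
    ENNReal.toReal_div, ENNReal.toReal_natCast, ENNReal.toReal_natCast]

section blockPerm

variable {ι : Type*} [Fintype ι] [Nonempty ι] [MeasurableSpace ι] [MeasurableSingletonClass ι]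
  (e : UnitIco ≃ᵐ ι × UnitIco)
  (he : MeasurePreserving e volume ((uniformOn (univ : Set ι)).prod volume))
  (q : Equiv.Perm ι) (R : InvMPT)

theorem apply_blockPerm (x : UnitIco) : e (blockPerm e he q R x) = (q (e x).1, R (e x).2) :=
  e.apply_symm_apply _

theorem apply_blockPerm_iterate (k : ℕ) (x : UnitIco) :
    e ((blockPerm e he q R)^[k] x) = ((q ^ k) (e x).1, R^[k] (e x).2) := by
  induction k with
  | zero => simp
  | succ k ih =>
    rw [iterate_succ_apply', apply_blockPerm, ih, iterate_succ_apply', pow_succ',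
      Equiv.Perm.mul_apply]

end blockPerm

/-- The identity transformation. -/
noncomputable def refl : InvMPT := ⟨MeasurableEquiv.refl _, MeasurePreserving.id _⟩

/-- The rotation of `[0,1)` by `1/T`. -/
noncomputable def rotation (T : ℕ) [NeZero T] : InvMPT :=
  blockPerm (cellEquiv T) (measurePreserving_cellEquiv T) (Equiv.addRight 1) refl

theorem rotation_iterate_eq_self_iff (T : ℕ) [NeZero T] (k : ℕ) (x : UnitIco) :
    (rotation T)^[k] x = x ↔ T ∣ k := by
  have hid : (refl : UnitIco → UnitIco) = id := rfl
  have hpow (a : Fin T) : (((Equiv.addRight (1 : Fin T)) ^ k) a = a) ↔ T ∣ k := by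
    have hadd : ((Equiv.addRight (1 : Fin T)) ^ k) a = a + k • (1 : Fin T) := by
      induction k with
      | zero => simp
      | succ k ih =>
        rw [pow_succ', Equiv.Perm.mul_apply, ih, succ_nsmul, ← add_assoc]
        rfl
    rw [hadd, add_eq_left, Fin.ext_iff, Fin.val_zero]
    have : ((k • (1 : Fin T) : Fin T) : ℕ) = k % T := by
      clear hadd
      induction k with
      | zero => simp
      | succ k ih => rw [succ_nsmul, Fin.val_add, ih, Fin.val_one', Nat.add_mod k 1 T]
    rw [this, Nat.dvd_iff_mod_eq_zero]
  rw [← (cellEquiv T).injective.eq_iff, rotation, apply_blockPerm_iterate, hid, iterate_id,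
    ← hpow (cellEquiv T x).1, Prod.ext_iff]
  simp

/-! ### Approximation by permutations of cells -/

/-- A nonnegative integer matrix with row and column sums at most `S` is dominated by the matrix
counting how many points each block of `Fin n × Fin S` sends to each block under a suitable
permutation. The row bounds leave room to choose `c j k` disjoint starting points in the block `j`,
the column bounds to choose as many end points in the block `k`, and the resulting partial injection
extends to a permutation. -/
theorem exists_perm_le_ncard {n S : ℕ} (c : Fin n → Fin n → ℕ) (hrow : ∀ j, ∑ k, c j k ≤ S)
    (hcol : ∀ k, ∑ j, c j k ≤ S) :
    ∃ q : Equiv.Perm (Fin n × Fin S), ∀ j k, c j k ≤ {s : Fin S | (q (j, s)).1 = k}.ncard := by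
  have ha (j : Fin n) : Nonempty ((Σ k, Fin (c j k)) ↪ Fin S) :=
    Embedding.nonempty_of_card_le (by simpa using hrow j)
  have hb (k : Fin n) : Nonempty ((Σ j, Fin (c j k)) ↪ Fin S) :=
    Embedding.nonempty_of_card_le (by simpa using hcol k)
  obtain ⟨q, hq⟩ := Equiv.Perm.exists_extending_pair
    (fun x : Σ p : Fin n × Fin n, Fin (c p.1 p.2) => (x.1.1, (ha x.1.1).some ⟨x.1.2, x.2⟩))
    (fun x : Σ p : Fin n × Fin n, Fin (c p.1 p.2) => (x.1.2, (hb x.1.2).some ⟨x.1.1, x.2⟩))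
    (by
      rintro ⟨⟨j, k⟩, i⟩ ⟨⟨j', k'⟩, i'⟩ h
      obtain ⟨h1, h2⟩ := Prod.ext_iff.1 h
      obtain rfl : j = j' := h1
      have h3 := (ha j).some.injective h2
      obtain ⟨rfl, h4⟩ := Sigma.mk.inj_iff.1 h3
      exact Sigma.ext rfl h4)
    (by
      rintro ⟨⟨j, k⟩, i⟩ ⟨⟨j', k'⟩, i'⟩ h
      obtain ⟨h1, h2⟩ := Prod.ext_iff.1 h
      obtain rfl : k = k' := h1
      have h3 := (hb k).some.injective h2
      obtain ⟨rfl, h4⟩ := Sigma.mk.inj_iff.1 h3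
      exact Sigma.ext rfl h4)
  refine ⟨q, fun j k => ?_⟩
  have hinj : Injective fun i : Fin (c j k) => (ha j).some ⟨k, i⟩ := fun i i' h => by
    simpa using (ha j).some.injective h
  calc c j k = (range fun i : Fin (c j k) => (ha j).some ⟨k, i⟩).ncard := by
        rw [← image_univ, ncard_image_of_injective _ hinj, ncard_univ, Nat.card_fin]
    _ ≤ _ := by
        refine ncard_le_ncard ?_ (toFinite _)
        rintro _ ⟨i, rfl⟩
        exact congrArg Prod.fst (hq ⟨(j, k), i⟩)

/-- One-sided bounds between the laws of two maps to a finite set, one for each point, give bounds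
in the other direction on all events, since both laws have total mass one. -/
theorem measureReal_preimage_le_add {Ω ι : Type*} [MeasurableSpace Ω] {μ : Measure Ω}
    [IsProbabilityMeasure μ] [Fintype ι] [MeasurableSpace ι] [MeasurableSingletonClass ι]
    {u v : Ω → ι} (hu : Measurable u) (hv : Measurable v) {δ : ℝ}
    (h : ∀ i, μ.real (u ⁻¹' {i}) ≤ μ.real (v ⁻¹' {i}) + δ) (hδ : 0 ≤ δ) (P : Set ι) :
    μ.real (v ⁻¹' P) ≤ μ.real (u ⁻¹' P) + Fintype.card ι * δ := by
  classical
  have key : μ.real (u ⁻¹' Pᶜ) ≤ μ.real (v ⁻¹' Pᶜ) + Fintype.card ι * δ := by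
    have hsum (w : Ω → ι) (hw : Measurable w) :
        μ.real (w ⁻¹' Pᶜ) = ∑ i ∈ Pᶜ.toFinset, μ.real (w ⁻¹' {i}) := by
      rw [sum_measureReal_preimage_singleton _ fun i _ => hw (measurableSet_singleton i)]
      simp
    rw [hsum u hu, hsum v hv]
    calc _ ≤ ∑ i ∈ Pᶜ.toFinset, (μ.real (v ⁻¹' {i}) + δ) := Finset.sum_le_sum fun i _ => h i
      _ = ∑ i ∈ Pᶜ.toFinset, μ.real (v ⁻¹' {i}) + Pᶜ.toFinset.card * δ := by
        rw [Finset.sum_add_distrib, Finset.sum_const, nsmul_eq_mul]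
      _ ≤ _ := by gcongr; exact Finset.card_le_univ _
  rw [preimage_compl, preimage_compl, probReal_compl_eq_one_sub (hu (Set.toFinite P).measurableSet),
    probReal_compl_eq_one_sub (hv (Set.toFinite P).measurableSet)] at key
  linarith

/-- The refinement of the `n` cells of `[0,1)` into `S` subcells each. -/
noncomputable def subcellEquiv (n S : ℕ) [NeZero n] [NeZero S] :
    UnitIco ≃ᵐ (Fin n × Fin S) × UnitIco :=
  ((cellEquiv n).trans (MeasurableEquiv.prodCongr (MeasurableEquiv.refl _) (cellEquiv S))).trans
    MeasurableEquiv.prodAssoc.symm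

theorem measurePreserving_subcellEquiv (n S : ℕ) [NeZero n] [NeZero S] :
    MeasurePreserving (subcellEquiv n S) volume
      ((uniformOn (univ : Set (Fin n × Fin S))).prod volume) := by
  rw [← uniformOn_univ_prod]
  exact ((measurePreserving_prodAssoc _ _ _).symm _).comp
    (((MeasurePreserving.id _).prod (measurePreserving_cellEquiv S)).comp
      (measurePreserving_cellEquiv n))

theorem measurable_cellEquiv_fst (n : ℕ) [NeZero n] :
    Measurable fun x => (cellEquiv n x).1 :=
  measurable_fst.comp (cellEquiv n).measurable

theorem volume_real_cell_preimage (n : ℕ) [NeZero n] (τ₀ : InvMPT) (P : Set (Fin n)) :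
    volume.real {x | (cellEquiv n (τ₀ x)).1 ∈ P} = P.ncard / n := by
  have h := τ₀.measurePreserving.measureReal_preimage
    (measurable_cellEquiv_fst n P.toFinite.measurableSet).nullMeasurableSet
  have h2 := volume_real_fst_mem (cellEquiv n) (measurePreserving_cellEquiv n) P
  rw [Fintype.card_fin] at h2
  exact h.trans h2

/-- The transition frequencies of `τ₀` between the `n` cells are realised, up to an error `n / S`,
by a permutation of subcells, whatever is done inside the subcells. -/
theorem exists_perm_transition_le (τ₀ : InvMPT) (n S : ℕ) [NeZero n] [NeZero S] :
    ∃ q : Equiv.Perm (Fin n × Fin S), ∀ (R : InvMPT) (P : Set (Fin n × Fin n)),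
      volume.real {x | ((cellEquiv n x).1, (cellEquiv n
        (blockPerm (subcellEquiv n S) (measurePreserving_subcellEquiv n S) q R x)).1) ∈ P} ≤
      volume.real {x | ((cellEquiv n x).1, (cellEquiv n (τ₀ x)).1) ∈ P} + n / S := by
  have hn : (0 : ℝ) < n := by exact_mod_cast NeZero.pos n
  have hS : (0 : ℝ) < S := by exact_mod_cast NeZero.pos S
  set u : UnitIco → Fin n × Fin n := fun x => ((cellEquiv n x).1, (cellEquiv n (τ₀ x)).1) with hu
  have hum : Measurable u := (measurable_cellEquiv_fst n).prodMk
    ((measurable_cellEquiv_fst n).comp τ₀.toMeasurableEquiv.measurable)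
  -- round the transition frequencies of `τ₀`, scaled by the number of subcells, down to integers
  set c : Fin n → Fin n → ℕ := fun j k => ⌊(n * S : ℝ) * volume.real (u ⁻¹' {(j, k)})⌋₊ with hc
  have hcle (j k : Fin n) : (c j k : ℝ) ≤ (n * S : ℝ) * volume.real (u ⁻¹' {(j, k)}) :=
    Nat.floor_le (by positivity)
  have hrow (j : Fin n) : ∑ k, c j k ≤ S := by
    have h : ∑ k, volume.real (u ⁻¹' {(j, k)}) = 1 / n := by
      have h1 := volume_real_cell_preimage n refl {j}
      rw [ncard_singleton, Nat.cast_one] at h1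
      have h2 := sum_measureReal_preimage_singleton (μ := volume) (f := u)
        (({j} : Finset (Fin n)) ×ˢ Finset.univ) fun p _ => hum (measurableSet_singleton p)
      rw [Finset.sum_product, Finset.sum_singleton] at h2
      rw [h2, ← h1]
      congr 1
      ext x
      simp [hu, refl, eq_comm (a := j)]
    have : ((∑ k, c j k : ℕ) : ℝ) ≤ S := by
      push_cast
      refine (Finset.sum_le_sum fun k _ => hcle j k).trans (le_of_eq ?_)
      rw [← Finset.mul_sum, h]
      field_simp
    exact_mod_cast this
  have hcol (k : Fin n) : ∑ j, c j k ≤ S := by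
    have h : ∑ j, volume.real (u ⁻¹' {(j, k)}) = 1 / n := by
      have h1 := volume_real_cell_preimage n τ₀ {k}
      rw [ncard_singleton, Nat.cast_one] at h1
      have h2 := sum_measureReal_preimage_singleton (μ := volume) (f := u)
        (Finset.univ ×ˢ ({k} : Finset (Fin n))) fun p _ => hum (measurableSet_singleton p)
      rw [Finset.sum_product] at h2
      simp only [Finset.sum_singleton] at h2
      rw [h2, ← h1]
      congr 1
      ext x
      simp [hu, eq_comm (a := k)]
    have : ((∑ j, c j k : ℕ) : ℝ) ≤ S := by
      push_cast
      refine (Finset.sum_le_sum fun j _ => hcle j k).trans (le_of_eq ?_)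
      rw [← Finset.mul_sum, h]
      field_simp
    exact_mod_cast this
  obtain ⟨q, hq⟩ := exists_perm_le_ncard c hrow hcol
  refine ⟨q, fun R P => ?_⟩
  set σ := blockPerm (subcellEquiv n S) (measurePreserving_subcellEquiv n S) q R with hσ
  set v : UnitIco → Fin n × Fin n := fun x => ((cellEquiv n x).1, (cellEquiv n (σ x)).1) with hv
  have hvm : Measurable v := (measurable_cellEquiv_fst n).prodMk
    ((measurable_cellEquiv_fst n).comp σ.toMeasurableEquiv.measurable)
  have h := measureReal_preimage_le_add (μ := volume) hum hvm (δ := 1 / (n * S)) ?_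
    (by positivity) P
  · refine h.trans (le_of_eq ?_)
    rw [Fintype.card_prod, Fintype.card_fin]
    push_cast
    congr 1
    field_simp
  · rintro ⟨j, k⟩
    have hcell (x : UnitIco) : (cellEquiv n x).1 = (subcellEquiv n S x).1.1 := rfl
    have hpre : v ⁻¹' {(j, k)} =
        {x | (subcellEquiv n S x).1 ∈ {p : Fin n × Fin S | p.1 = j ∧ (q p).1 = k}} := by
      ext x
      simp only [hv, mem_preimage, mem_singleton_iff, Prod.mk.injEq, mem_ofPred_eq, hcell, hσ,
        apply_blockPerm]
    have hcard : {s : Fin S | (q (j, s)).1 = k}.ncard ≤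
        {p : Fin n × Fin S | p.1 = j ∧ (q p).1 = k}.ncard := by
      rw [← ncard_image_of_injective _ (Prod.mk_right_injective j)]
      refine ncard_le_ncard ?_ (toFinite _)
      rintro _ ⟨s, hs, rfl⟩
      exact ⟨rfl, hs⟩
    rw [hpre, volume_real_fst_mem _ (measurePreserving_subcellEquiv n S)]
    have h1 : (c j k : ℝ) ≤ {p : Fin n × Fin S | p.1 = j ∧ (q p).1 = k}.ncard := by
      exact_mod_cast (hq j k).trans hcard
    have h2 := Nat.lt_floor_add_one ((n * S : ℝ) * volume.real (u ⁻¹' {(j, k)}))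
    have h3 : (n * S : ℝ) * volume.real (u ⁻¹' {(j, k)}) ≤
      {p : Fin n × Fin S | p.1 = j ∧ (q p).1 = k}.ncard + 1 := h2.le.trans (by simpa [hc] using h1)
    rw [Fintype.card_prod,
      Fintype.card_fin, Fintype.card_fin, Nat.cast_mul, ← add_div, le_div_iff₀ (by positivity)]
    linarith

/-- Transformations all of whose orbits have one and the same, arbitrarily large, finite length
are dense. -/
theorem exists_periodic_symmDiff_lt (τ₀ : InvMPT) (F : Finset (Set UnitIco))
    (hF : ∀ A ∈ F, MeasurableSet A) {ε : ℝ} (hε : 0 < ε) (N : ℕ) :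
    ∃ (σ : InvMPT) (T : ℕ), N < T ∧ (∀ k x, σ^[k] x = x ↔ T ∣ k) ∧
      ∀ A ∈ F, volume.real ((σ '' A) ∆ (τ₀ '' A)) < ε := by
  have hε5 : 0 < ε / 5 := by positivity
  have hev : ∀ᶠ n : ℕ in atTop, n ≠ 0 ∧ ∀ A ∈ F, ∀ _ : NeZero n,
      (∃ J : Set (Fin n), volume.real (A ∆ {x | (cellEquiv n x).1 ∈ J}) < ε / 5) ∧
      (∃ J : Set (Fin n), volume.real ((τ₀ '' A) ∆ {x | (cellEquiv n x).1 ∈ J}) < ε / 5) := by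
    refine (eventually_ne_atTop 0).and ((Filter.eventually_all_finset F).2 fun A hA => ?_)
    filter_upwards [eventually_exists_symmDiff_cells_lt (hF A hA) hε5,
      eventually_exists_symmDiff_cells_lt (τ₀.measurableSet_image (hF A hA)) hε5] with n h1 h2 h0
    exact ⟨h1 h0, h2 h0⟩
  obtain ⟨n, hn, hcells⟩ := hev.exists
  have : NeZero n := ⟨hn⟩
  obtain ⟨S, hS⟩ := exists_nat_gt (n / (ε / 5))
  have hS0 : (0 : ℝ) < S := lt_of_le_of_lt (by positivity) hS
  have : NeZero S := ⟨by rintro rfl; simp at hS0⟩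
  have hnS : (n : ℝ) / S < ε / 5 := by
    rw [div_lt_iff₀ hε5] at hS
    rw [div_lt_iff₀ hS0]
    linarith
  obtain ⟨q, hq⟩ := exists_perm_transition_le τ₀ n S
  -- a rotation inside the subcells, with period a multiple of the order of `q`, gives all orbits
  -- the same length
  have hT : 0 < orderOf q * (N + 1) := by have := orderOf_pos q; positivity
  have : NeZero (orderOf q * (N + 1)) := ⟨hT.ne'⟩
  refine ⟨blockPerm (subcellEquiv n S) (measurePreserving_subcellEquiv n S) q
    (rotation (orderOf q * (N + 1))), orderOf q * (N + 1), ?_, fun k x => ?_, fun A hA => ?_⟩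
  · have := orderOf_pos q
    nlinarith
  · rw [← (subcellEquiv n S).injective.eq_iff, apply_blockPerm_iterate, Prod.ext_iff,
      rotation_iterate_eq_self_iff]
    refine and_iff_right_of_imp fun h => ?_
    rw [orderOf_dvd_iff_pow_eq_one.1 ((dvd_mul_right _ _).trans h), Equiv.Perm.one_apply]
  · obtain ⟨⟨J, hJ⟩, ⟨J', hJ'⟩⟩ := hcells A hA inferInstance
    set σ := blockPerm (subcellEquiv n S) (measurePreserving_subcellEquiv n S) q
      (rotation (orderOf q * (N + 1)))
    set A' := {x | (cellEquiv n x).1 ∈ J}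
    set B := τ₀ '' A
    set B' := {x | (cellEquiv n x).1 ∈ J'}
    have hA'm : MeasurableSet A' := measurable_cellEquiv_fst n J.toFinite.measurableSet
    have hB'm : MeasurableSet B' := measurable_cellEquiv_fst n J'.toFinite.measurableSet
    have hBm : MeasurableSet B := τ₀.measurableSet_image (hF A hA)
    have htrans := hq (rotation (orderOf q * (N + 1))) {p | p.1 ∈ J ∧ p.2 ∉ J' ∨ p.2 ∈ J' ∧ p.1 ∉ J}
    change volume.real (A' ∆ (σ ⁻¹' B')) ≤ volume.real (A' ∆ (τ₀ ⁻¹' B')) + n / S at htrans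
    have hpre (τ : InvMPT) : volume.real ((τ ⁻¹' B') ∆ (τ ⁻¹' B)) < ε / 5 := by
      rw [← preimage_symmDiff, τ.measurePreserving.measureReal_preimage
        (hB'm.symmDiff hBm).nullMeasurableSet, symmDiff_comm]
      exact hJ'
    have h0 : τ₀ ⁻¹' B = A := preimage_image_eq _ τ₀.toMeasurableEquiv.injective
    have h1 : volume.real ((σ '' A) ∆ B) = volume.real (A ∆ (σ ⁻¹' B)) := by
      rw [measureReal_def, measureReal_def, ← measure_image σ (A ∆ (σ ⁻¹' B)),
        image_symmDiff σ.toMeasurableEquiv.injective,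
        image_preimage_eq _ σ.toMeasurableEquiv.surjective]
    -- the five errors: replacing `A` by `A'` twice, `B` by `B'` twice, and the error of `q`
    have hp := hpre τ₀
    rw [h0] at hp
    have e1 := measureReal_symmDiff_le (μ := volume) (s := A) (t := A') (σ ⁻¹' B)
    have e2 := measureReal_symmDiff_le (μ := volume) (s := A') (t := σ ⁻¹' B') (σ ⁻¹' B)
    have e3 := measureReal_symmDiff_le (μ := volume) (s := A') (t := A) (τ₀ ⁻¹' B')
    rw [symmDiff_comm A' A, symmDiff_comm A (τ₀ ⁻¹' B')] at e3
    have hp' := hpre σ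
    rw [h1]
    linarith

/-! ### Birkhoff sums along periodic orbits -/

theorem birkhoffSum_iterate_eq_of_isPeriodicPt {α : Type*} {g : α → α} {f : α → ℝ} {p : ℕ} {x : α}
    (h : IsPeriodicPt g p x) (m : ℕ) :
    birkhoffSum g f p (g^[m] x) = birkhoffSum g f p x := by
  induction m with
  | zero => rfl
  | succ m ih =>
    have h1 := birkhoffSum_apply_sub_birkhoffSum g f p (g^[m] x)
    rw [(h.apply_iterate m).eq, sub_self, sub_eq_zero, ← iterate_succ_apply' g m x, ih] at h1
    exact h1

theorem birkhoffSum_mul_of_isPeriodicPt {α : Type*} {g : α → α} {f : α → ℝ} {p : ℕ} {x : α}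
    (h : IsPeriodicPt g p x) (j : ℕ) :
    birkhoffSum g f (p * j) x = j * birkhoffSum g f p x := by
  induction j with
  | zero => simp
  | succ j ih =>
    rw [Nat.mul_succ, birkhoffSum_add, ih, (h.mul_const j).eq]
    push_cast
    ring

/-! ### Removing a set of points from the orbits -/

/-- Given a set `E` disjoint from its image under `σ`, the transformation that fixes the points of
`E` and lets every other orbit jump over them: `x ↦ σ (σ x)` when `σ x ∈ E`, and `x ↦ σ x`
otherwise. -/
noncomputable def removePoints (σ : InvMPT) (E : Set UnitIco) (hE : MeasurableSet E)
    (hdisj : ∀ x ∈ E, σ x ∉ E) : InvMPT := by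
  classical
  let s := σ.toMeasurableEquiv
  have hs : Measurable s := s.measurable
  have hs' : Measurable s.symm := s.symm.measurable
  let toFun : UnitIco → UnitIco := fun x => if x ∈ E then x else if s x ∈ E then s (s x) else s x
  let invFun : UnitIco → UnitIco := fun y =>
    if y ∈ E then y else if s.symm y ∈ E then s.symm (s.symm y) else s.symm y
  have hm : Measurable toFun :=
    Measurable.ite hE measurable_id (Measurable.ite (hs hE) (hs.comp hs) hs)
  have hm' : Measurable invFun :=
    Measurable.ite hE measurable_id (Measurable.ite (hs' hE) (hs'.comp hs') hs')
  refine ⟨⟨⟨toFun, invFun, fun x => ?_, fun y => ?_⟩, hm, hm'⟩, ?_⟩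
  · by_cases h1 : x ∈ E
    · simp [toFun, invFun, h1]
    by_cases h2 : s x ∈ E
    · have h3 : s (s x) ∉ E := hdisj _ h2
      simp [toFun, invFun, h1, h2, h3]
    · simp [toFun, invFun, h1, h2]
  · by_cases h1 : y ∈ E
    · simp [toFun, invFun, h1]
    by_cases h2 : s.symm y ∈ E
    · have h3 : s.symm (s.symm y) ∉ E := fun h => hdisj _ h (by
        change s (s.symm (s.symm y)) ∈ E
        simpa using h2)
      simp [toFun, invFun, h1, h2, h3]
    · simp [toFun, invFun, h1, h2]
  · change MeasurePreserving toFun volume volume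
    refine ⟨hm, ?_⟩
    -- for probability measures an inequality between them is an equality
    have : IsProbabilityMeasure (Measure.map toFun volume) :=
      Measure.isProbabilityMeasure_map hm.aemeasurable
    refine Measure.eq_of_le_of_isProbabilityMeasure (Measure.le_iff.2 fun B hB => ?_)
    have hEs : MeasurableSet (s.symm ⁻¹' E) := hs' hE
    rw [Measure.map_apply hm hB]
    have hsub : toFun ⁻¹' B ⊆ (B ∩ E) ∪ ((s ∘ s) ⁻¹' ((B \ E) ∩ s.symm ⁻¹' E) ∪
        s ⁻¹' ((B \ E) \ s.symm ⁻¹' E)) := by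
      intro x hx
      have hx' : toFun x ∈ B := hx
      by_cases h1 : x ∈ E
      · left; simpa [toFun, h1] using hx'
      right
      by_cases h2 : s x ∈ E
      · have h3 : s (s x) ∉ E := hdisj _ h2
        left
        have : s (s x) ∈ B := by simpa [toFun, h1, h2] using hx'
        simp [this, h2, h3]
      · right
        have : s x ∈ B := by simpa [toFun, h1, h2] using hx'
        simp [this, h1, h2]
    have hmp : MeasurePreserving s volume volume := σ.measurePreserving
    calc volume (toFun ⁻¹' B) ≤ _ := measure_mono hsub
      _ ≤ _ := (measure_union_le _ _).trans (add_le_add_right (measure_union_le _ _) _)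
      _ = volume (B ∩ E) + (volume ((B \ E) ∩ s.symm ⁻¹' E) +
          volume ((B \ E) \ s.symm ⁻¹' E)) := by
        rw [(hmp.comp hmp).measure_preimage ((hB.diff hE).inter hEs).nullMeasurableSet,
          hmp.measure_preimage ((hB.diff hE).diff hEs).nullMeasurableSet]
      _ = volume B := by rw [measure_inter_add_sdiff _ hEs, measure_inter_add_sdiff _ hE]

section removePoints

variable (σ : InvMPT) (E : Set UnitIco) (hE : MeasurableSet E) (hdisj : ∀ x ∈ E, σ x ∉ E)

theorem removePoints_of_image_mem {x : UnitIco} (h : x ∉ E) (h' : σ x ∈ E) :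
    removePoints σ E hE hdisj x = σ (σ x) := by
  classical
  change (if x ∈ E then x else if σ x ∈ E then σ (σ x) else σ x) = _
  rw [if_neg h, if_pos h']

theorem removePoints_of_image_notMem {x : UnitIco} (h : x ∉ E) (h' : σ x ∉ E) :
    removePoints σ E hE hdisj x = σ x := by
  classical
  change (if x ∈ E then x else if σ x ∈ E then σ (σ x) else σ x) = _
  rw [if_neg h, if_neg h']

theorem removePoints_iterate {x : UnitIco} {n : ℕ} (h : ∀ k ≤ n, σ^[k] x ∉ E) :
    (removePoints σ E hE hdisj)^[n] x = σ^[n] x := by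
  induction n with
  | zero => rfl
  | succ n ih =>
    rw [iterate_succ_apply', ih fun k hk => h k (hk.trans n.le_succ), iterate_succ_apply']
    refine removePoints_of_image_notMem _ _ _ _ (h n n.le_succ) ?_
    rw [← iterate_succ_apply' σ n x]
    exact h _ le_rfl

theorem measureReal_symmDiff_removePoints_le (A : Set UnitIco) :
    volume.real ((removePoints σ E hE hdisj '' A) ∆ (σ '' A)) ≤ 4 * volume.real E := by
  set τ := removePoints σ E hE hdisj
  have hD : volume.real (E ∪ σ ⁻¹' E) ≤ 2 * volume.real E := by
    have h := measureReal_union_le (μ := volume) E (σ ⁻¹' E)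
    rw [σ.measurePreserving.measureReal_preimage hE.nullMeasurableSet] at h
    linarith
  have himg (ρ : InvMPT) (B : Set UnitIco) : volume.real (ρ '' B) = volume.real B := by
    rw [measureReal_def, measure_image, measureReal_def]
  have hsub : (τ '' A) ∆ (σ '' A) ⊆ (τ '' (E ∪ σ ⁻¹' E)) ∪ (σ '' (E ∪ σ ⁻¹' E)) := by
    have heq (x : UnitIco) (hx : x ∉ E ∪ σ ⁻¹' E) : τ x = σ x := by
      rw [mem_union, not_or] at hx
      exact removePoints_of_image_notMem _ _ _ _ hx.1 hx.2
    rintro _ (⟨⟨x, hx, rfl⟩, hn⟩ | ⟨⟨x, hx, rfl⟩, hn⟩)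
    · refine Or.inl (mem_image_of_mem _ (by_contra fun h => hn ⟨x, hx, (heq x h).symm⟩))
    · refine Or.inr (mem_image_of_mem _ (by_contra fun h => hn ⟨x, hx, heq x h⟩))
  have h := (measureReal_mono (μ := volume) hsub).trans (measureReal_union_le _ _)
  rw [himg, himg] at h
  linarith

end removePoints

/-! ### Making the sums over the orbits nonzero -/

/-- A set meeting each orbit of a transformation of exact period `T` at most once has measure at
most `1 / T`. -/
theorem measureReal_le_of_forall_iterate_notMem {σ : InvMPT} {T : ℕ} (hT : 0 < T)
    {E : Set UnitIco} (hE : MeasurableSet E)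
    (h : ∀ x ∈ E, ∀ k, 0 < k → k < T → σ^[k] x ∉ E) : volume.real E ≤ 1 / T := by
  have hdisj : (↑(Finset.range T) : Set ℕ).PairwiseDisjoint fun k => σ^[k] ⁻¹' E := by
    have key (i j : ℕ) (hij : i < j) (hj : j < T) : Disjoint (σ^[i] ⁻¹' E) (σ^[j] ⁻¹' E) := by
      refine disjoint_left.2 fun x hx hx' => h _ hx (j - i) (by omega) (by omega) ?_
      rw [← iterate_add_apply, Nat.sub_add_cancel hij.le]
      exact hx'
    intro i hi j hj hij
    simp only [Finset.coe_range, mem_Iio] at hi hj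
    rcases hij.lt_or_gt with hij | hij
    exacts [key i j hij hj, (key j i hij hi).symm]
  have hsum := measureReal_biUnion_finset (μ := volume) hdisj
    fun k _ => (σ.measurePreserving_iterate k).measurable hE
  have hconst (k : ℕ) : volume.real (σ^[k] ⁻¹' E) = volume.real E :=
    (σ.measurePreserving_iterate k).measureReal_preimage hE.nullMeasurableSet
  simp only [hconst, Finset.sum_const, Finset.card_range, nsmul_eq_mul] at hsum
  have hT' : (0 : ℝ) < T := by exact_mod_cast hT
  rw [le_div_iff₀ hT', mul_comm, ← hsum]
  exact measureReal_le_one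

/-- Removing at most one point from each orbit makes the sum of `f` over the orbits of almost all
points of `{f ≠ 0}` nonzero: if the sum over an orbit vanishes, then the sum over the orbit
without the point `z` is `-f z`. -/
theorem exists_birkhoffSum_ne_zero {σ : InvMPT} {T : ℕ} (hT : 1 < T)
    (hσ : ∀ x, IsPeriodicPt σ T x) (hσ' : ∀ k x, σ^[k] x = x → T ∣ k)
    {f : UnitIco → ℝ} (hf : Measurable f) :
    ∃ (τ : InvMPT) (E : Set UnitIco) (M : ℕ), MeasurableSet E ∧ volume.real E ≤ 1 / T ∧
      (∀ A, volume.real ((τ '' A) ∆ (σ '' A)) ≤ 4 / T) ∧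
      ∀ x, f x ≠ 0 → x ∉ E → IsPeriodicPt τ M x ∧ birkhoffSum τ f M x ≠ 0 := by
  have hT0 : 0 < T := by omega
  have hiter (k : ℕ) : Measurable σ^[k] := (σ.measurePreserving_iterate k).measurable
  have hFm : Measurable (birkhoffSum σ f T) :=
    Finset.measurable_sum (f := fun k x => f (σ^[k] x)) _ fun k _ => hf.comp (hiter k)
  -- on each orbit with sum zero, pick the smallest point at which `f` does not vanish
  set E : Set UnitIco := {x | birkhoffSum σ f T x = 0} ∩ {x | f x ≠ 0} ∩
    ⋂ k ∈ Finset.range T, ({x | f (σ^[k] x) = 0} ∪ {x | (x : ℝ) ≤ (σ^[k] x : UnitIco)}) with hEdef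
  have hE : MeasurableSet E := by
    refine ((hFm (measurableSet_singleton 0)).inter (hf (measurableSet_singleton 0).compl)).inter
      (Finset.measurableSet_biInter _ fun k _ => ?_)
    exact ((hf.comp (hiter k)) (measurableSet_singleton 0)).union
      (measurableSet_le measurable_subtype_coe (measurable_subtype_coe.comp (hiter k)))
  have hmem (x : UnitIco) : x ∈ E ↔ birkhoffSum σ f T x = 0 ∧ f x ≠ 0 ∧
      ∀ k < T, f (σ^[k] x) ≠ 0 → (x : ℝ) ≤ (σ^[k] x : UnitIco) := by
    simp [hEdef, and_assoc, or_iff_not_imp_left]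
  have honce : ∀ x ∈ E, ∀ k, 0 < k → k < T → σ^[k] x ∉ E := by
    intro x hx k hk hkT hx'
    have h1 := ((hmem x).1 hx).2.2 k hkT ((hmem _).1 hx').2.1
    have hback : σ^[T - k] (σ^[k] x) = x := by
      rw [← iterate_add_apply, Nat.sub_add_cancel hkT.le]
      exact hσ x
    have h2 := ((hmem _).1 hx').2.2 (T - k) (by omega) (by rw [hback]; exact ((hmem x).1 hx).2.1)
    rw [hback] at h2
    exact Nat.not_dvd_of_pos_of_lt hk hkT (hσ' k x (Subtype.ext (le_antisymm h2 h1)))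
  have hdisj : ∀ x ∈ E, σ x ∉ E := fun x hx => honce x hx 1 one_pos hT
  have hEle := measureReal_le_of_forall_iterate_notMem hT0 hE honce
  set τ := removePoints σ E hE hdisj with hτ
  have hFinv (m : ℕ) (x : UnitIco) : birkhoffSum σ f T (σ^[m] x) = birkhoffSum σ f T x :=
    birkhoffSum_iterate_eq_of_isPeriodicPt (hσ x) m
  refine ⟨τ, E, T * (T - 1), hE, hEle, fun A => ?_, fun x hfx hxE => ?_⟩
  · refine (measureReal_symmDiff_removePoints_le σ E hE hdisj A).trans ?_
    rw [div_eq_mul_one_div]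
    linarith
  have hTpos : (0 : ℝ) < T := by exact_mod_cast hT0
  have hT1pos : (0 : ℝ) < (T - 1 : ℕ) := by exact_mod_cast Nat.sub_pos_of_lt hT
  by_cases hF : birkhoffSum σ f T x = 0
  · obtain ⟨k, hk, hmin⟩ := Finset.exists_min_image
      ((Finset.range T).filter fun k => f (σ^[k] x) ≠ 0) (fun k => ((σ^[k] x : UnitIco) : ℝ))
      ⟨0, by simpa using ⟨hT0, hfx⟩⟩
    simp only [Finset.mem_filter, Finset.mem_range] at hk hmin
    obtain ⟨hkT, hfk⟩ := hk
    set z := σ^[k] x with hz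
    have hzE : z ∈ E := by
      refine (hmem z).2 ⟨(hFinv k x).trans hF, hfk, fun m hm hfm => ?_⟩
      have h1 : σ^[m] z = σ^[(m + k) % T] x := by
        rw [(hσ x).iterate_mod_apply, iterate_add_apply]
      rw [h1] at hfm ⊢
      exact hmin _ ⟨Nat.mod_lt _ hT0, hfm⟩
    have hk0 : k ≠ 0 := by
      rintro rfl
      exact hxE hzE
    -- the orbit of `σ z` under `τ` is the orbit of `z` under `σ` without `z`
    have horb (j : ℕ) (hj : j + 1 < T) : τ^[j] (σ z) = σ^[j + 1] z := by
      rw [iterate_succ_apply]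
      refine removePoints_iterate _ _ _ _ fun i hi => ?_
      rw [← iterate_succ_apply]
      exact honce z hzE (i + 1) (by omega) (by omega)
    have hper : IsPeriodicPt τ (T - 1) (σ z) := by
      obtain ⟨S, rfl⟩ : ∃ S, T = S + 2 := ⟨T - 2, by omega⟩
      change τ^[S + 1] (σ z) = σ z
      have hback : σ (σ^[S + 1] z) = z := by
        rw [← iterate_succ_apply' σ]
        exact hσ z
      rw [iterate_succ_apply', horb S (by omega), hτ, removePoints_of_image_mem, hback]
      · exact honce z hzE (S + 1) (by omega) (by omega)
      · rw [hback]
        exact hzE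
    have hx : x = τ^[T - k - 1] (σ z) := by
      rw [horb _ (by omega), Nat.sub_add_cancel (by omega), hz, ← iterate_add_apply,
        Nat.sub_add_cancel hkT.le]
      exact (hσ x).symm
    have hsum : birkhoffSum τ f (T - 1) (σ z) = -f z := by
      have h1 : birkhoffSum τ f (T - 1) (σ z) = birkhoffSum σ f (T - 1) (σ z) := by
        refine Finset.sum_congr rfl fun j hj => ?_
        rw [Finset.mem_range] at hj
        rw [horb j (by omega), iterate_succ_apply]
      have h2 := birkhoffSum_succ' σ f (T - 1) z
      rw [Nat.sub_add_cancel hT.le] at h2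
      have h3 := ((hmem z).1 hzE).1
      rw [h1]
      linarith
    have hperx : IsPeriodicPt τ (T - 1) x := by
      rw [hx]
      exact hper.apply_iterate _
    refine ⟨hperx.const_mul T, ?_⟩
    rw [mul_comm, birkhoffSum_mul_of_isPeriodicPt hperx, hx,
      birkhoffSum_iterate_eq_of_isPeriodicPt hper, hsum]
    exact mul_ne_zero hTpos.ne' (neg_ne_zero.2 hfk)
  · have hτσ (n : ℕ) : τ^[n] x = σ^[n] x :=
      removePoints_iterate _ _ _ _ fun k _ hk => hF ((hFinv k x).symm.trans ((hmem _).1 hk).1)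
    have hperx : IsPeriodicPt τ T x := (hτσ T).trans (hσ x)
    refine ⟨hperx.mul_const (T - 1), ?_⟩
    rw [birkhoffSum_mul_of_isPeriodicPt hperx]
    refine mul_ne_zero hT1pos.ne' ?_
    simpa only [birkhoffSum, hτσ] using hF

/-! ### Density -/

theorem mem_largeSums_of_isPeriodicPt {τ : InvMPT} {f : UnitIco → ℝ} {W : Set UnitIco} {M : ℕ}
    (h : ∀ x ∈ W, IsPeriodicPt τ M x ∧ birkhoffSum τ f M x ≠ 0) {η : ℝ}
    (hW : η < volume.real W) (K : ℕ) : τ ∈ largeSums f K η := by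
  have hmono : Monotone fun j : ℕ => {x ∈ W | (K : ℝ) < j * |birkhoffSum τ f M x|} := by
    intro i j hij x hx
    have : (i : ℝ) ≤ j := by exact_mod_cast hij
    exact ⟨hx.1, hx.2.trans_le (by gcongr)⟩
  have hU : (⋃ j : ℕ, {x ∈ W | (K : ℝ) < j * |birkhoffSum τ f M x|}) = W := by
    ext x
    refine ⟨fun hx => (mem_iUnion.1 hx).elim fun _ h => h.1, fun hx => ?_⟩
    obtain ⟨j, hj⟩ := exists_nat_gt (K / |birkhoffSum τ f M x|)
    rw [div_lt_iff₀ (abs_pos.2 (h x hx).2)] at hj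
    exact mem_iUnion.2 ⟨j, hx, hj⟩
  have ht := tendsto_measure_iUnion_atTop (μ := volume) hmono
  rw [hU] at ht
  have ht' := (ENNReal.tendsto_toReal (measure_ne_top volume _)).comp ht
  obtain ⟨j, hj⟩ := (ht'.eventually (lt_mem_nhds hW)).exists
  refine ⟨M * j, lt_of_lt_of_le hj (measureReal_mono fun x hx => ?_)⟩
  change (K : ℝ) < |birkhoffSum τ f (M * j) x|
  rw [birkhoffSum_mul_of_isPeriodicPt (h x hx.1).1, abs_mul, Nat.abs_cast]
  exact hx.2

theorem dense_iInter_largeSums_of_measurable {f : UnitIco → ℝ} (hf : Measurable f) {η : ℝ}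
    (hη : η < volume.real {x | f x ≠ 0}) : Dense (⋂ K : ℕ, largeSums f K η) := by
  rw [dense_iff_inter_open]
  rintro U hU ⟨τ₀, h₀⟩
  obtain ⟨F, ε, hε, hF, hFU⟩ := exists_finset_symmDiff_subset hU τ₀ h₀
  obtain ⟨N, hN⟩ := exists_nat_one_div_lt (lt_min (sub_pos.2 hη) (show 0 < ε / 8 by positivity))
  obtain ⟨σ, T, hNT, hσ, hσF⟩ :=
    exists_periodic_symmDiff_lt τ₀ F hF (half_pos hε) (N + 1)
  have hT : (1 : ℝ) / T < min (volume.real {x | f x ≠ 0} - η) (ε / 8) := by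
    refine lt_of_le_of_lt ?_ hN
    have : (N : ℝ) + 1 ≤ T := by exact_mod_cast hNT.le
    gcongr
  obtain ⟨τ, E, M, hE, hET, hτσ, hτ⟩ := exists_birkhoffSum_ne_zero (by omega)
    (fun x => (hσ T x).2 dvd_rfl) (fun k x => (hσ k x).1) hf
  refine ⟨τ, hFU τ fun A hA => ?_, mem_iInter.2 fun K => mem_largeSums_of_isPeriodicPt
    (W := {x | f x ≠ 0} \ E) (fun x hx => hτ x hx.1 hx.2) ?_ K⟩
  · have h1 := measureReal_symmDiff_le (μ := volume) (s := τ '' A) (t := σ '' A) (τ₀ '' A)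
    have h2 := hτσ A
    have h3 := hσF A hA
    have h4 := hT.trans_le (min_le_right _ _)
    rw [div_eq_mul_one_div] at h2
    linarith
  · have h1 := measureReal_mono (μ := volume)
      (show {x | f x ≠ 0} ⊆ ({x | f x ≠ 0} \ E) ∪ E by
        intro x hx; by_cases h : x ∈ E <;> simp_all)
    have h2 := measureReal_union_le (μ := volume) ({x | f x ≠ 0} \ E) E
    have h4 := hT.trans_le (min_le_left _ _)
    linarith

theorem largeSums_congr {f g : UnitIco → ℝ} (h : f =ᵐ[volume] g) (K : ℕ) (η : ℝ) :
    largeSums f K η = largeSums g K η := by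
  ext τ
  refine exists_congr fun n => ?_
  have h1 := τ.measurePreserving.quasiMeasurePreserving.birkhoffSum_ae_eq_of_ae_eq h n
  have h2 : {x : UnitIco | (K : ℝ) < |birkhoffSum τ f n x|} =ᵐ[volume]
      {x : UnitIco | (K : ℝ) < |birkhoffSum τ g n x|} := by
    filter_upwards [h1] with x hx
    change ((K : ℝ) < |birkhoffSum τ f n x|) = ((K : ℝ) < |birkhoffSum τ g n x|)
    rw [hx]
  rw [measureReal_congr h2]

/-- For `f` not almost everywhere zero, there are densely many transformations whose Birkhoff sums
are stochastically unbounded, with a uniform amount of escaping mass. -/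
theorem exists_dense_iInter_largeSums {f : UnitIco → ℝ} (hf : AEStronglyMeasurable f volume)
    (hne : ¬ f =ᵐ[volume] 0) : ∃ η : ℝ, 0 < η ∧ Dense (⋂ K : ℕ, largeSums f K η) := by
  have hpos : 0 < volume.real {x | hf.mk f x ≠ 0} := by
    refine ENNReal.toReal_pos (fun h => hne ?_) (measure_ne_top _ _)
    exact hf.ae_eq_mk.trans (ae_iff.2 h)
  refine ⟨volume.real {x | hf.mk f x ≠ 0} / 2, half_pos hpos, ?_⟩
  simp_rw [largeSums_congr hf.ae_eq_mk]
  exact dense_iInter_largeSums_of_measurable hf.stronglyMeasurable_mk.measurable (half_lt_self hpos)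

end InvMPT

theorem mainTheorem2 (f : UnitIco → ℝ) (hf : Integrable f volume)
    (hmean : ∫ x, f x = 0) (hne : ¬ f =ᵐ[volume] 0) :
    (∃ G : Set InvMPT, IsGδ G ∧ Dense G ∧ ∀ τ ∈ G, ¬ InvMPT.IsCoboundary f τ) ∧
    (∀ η : ℝ, 0 < η → ∀ K : ℕ, IsOpen (InvMPT.largeSums f K η)) ∧
    (∃ η : ℝ, 0 < η ∧ ∀ K : ℕ, Dense (InvMPT.largeSums f K η)) := by
  obtain ⟨η, hη, hdense⟩ := InvMPT.exists_dense_iInter_largeSums hf.1 hne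
  refine ⟨⟨⋂ K : ℕ, InvMPT.largeSums f K η, ?_, hdense, fun τ hτ => ?_⟩,
    fun η _ K => InvMPT.isOpen_largeSums hf K η, η, hη, fun K => hdense.mono (iInter_subset _ K)⟩
  · exact .iInter fun K => (InvMPT.isOpen_largeSums hf K η).isGδ
  · exact InvMPT.not_isCoboundary_of_forall_mem_largeSums hη (mem_iInter.1 hτ)
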